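/- Consider the discrete-time system $x_{t+1}=Ax_t+B_uu_t+B_ww_t$, $t\in\mathbb Z$, with real matrices, $x_t\in\mathbb R^{d_x}$, $u_t\in\mathbb R^{d_u}$, scalar disturbances $w_t\in\mathbb R$ ($d_w=1$) and regulated output $(Cx_t,u_t)$, where $C$ is a real matrix ($C=I$ gives the stage cost $\|x_t\|^2+\|u_t\|^2$). Assume that $A$ has no eigenvalue on the unit circle. Put $F(z)=C(zI-A)^{-1}B_u$ and $G(z)=C(zI-A)^{-1}B_w$, and let $\mathcal F,\mathcal G$ be the Laurent operators with the bounded symbols $F(e^{i\omega}),G(e^{i\omega})$ on the unit circle. Laurent operators $\mathcal M$ are identified with their symbols $M(e^{i\omega})=\sum_t\widehat M_te^{-i\omega t}$; $\mathcal M$ is causal if $\widehat M_t=0$ for $t<0$; $\{\mathcal M\}_+$ and $\{\mathcal M\}_-$ are the causal ($t\ge0$) and strictly anticausal ($t<0$) parts; $\mathcal L_p$ consists of the operators with symbol in $L_p$, and $\mathcal H_p$ of the causal ones among them; $\operatorname{tr}$ is the integral of the trace of the symbol against $d\omega/2\pi$. For a controller $\mathcal K\in\mathcal H_\infty^{d_u\times1}$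 with real Markov parameters $\widehat K_t$ let $\mathcal T_{\mathcal K}=\begin{bmatrix}\mathcal F\mathcal K+\mathcal G\\ \mathcal K\end{bmatrix}$, and let $\gamma_\infty=\inf_{\mathcal K}\|\mathcal T_{\mathcal K}\|_{\infty}$, where $\|\cdot\|_\infty$ is the $H_\infty$ norm. Let $\mathcal K_\circ=-(I+\mathcal F^*\mathcal F)^{-1}\mathcal F^*\mathcal G$ be the optimal non-causal controller, and define $\mathcal T_{\mathcal K_\circ}$ by the same formula. Let $\Delta\in\mathcal H_\infty^{d_u\times d_u}$ with $\Delta^{-1}\in\mathcal H_\infty^{d_u\times d_u}$ be a causal and causally invertible spectral factor, $\Delta^*\Delta=I+\mathcal F^*\mathcal F$. Let $\gamma>\gamma_\infty$. Let $\mathcal K_\gamma\in\mathcal H_\infty^{d_u\times1}$ be a controller as above, let $\Lambda_\gamma\in\mathcal L_1$ be a self-adjoint, positive semidefinite scalar Laurent operator with real Markov parameters, and let $\mathcal L_\gamma\in\mathcal H_2$, with causal inverse, be a spectral factor $\mathcal L_\gamma\mathcal L_\gamma^*=I+\Lambda_\gamma$. Consider the max-min problem $$\max_{\Lambda\in\mathcal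 L_1,\ \Lambda\succeq0}\ \min_{\mathcal K\in\mathcal H_\infty}\ \operatorname{tr}\big(\mathcal T_{\mathcal K}^*\mathcal T_{\mathcal K}(I+\Lambda)\big)-\gamma^2\operatorname{tr}(\Lambda).$$ Then: 1. $\gamma^2-\mathcal T_{\mathcal K_\circ}^*\mathcal T_{\mathcal K_\circ}\succeq\varepsilon I$ for some $\varepsilon>0$. 2. If $(\mathcal K_\gamma,\Lambda_\gamma)$ is a saddle point of the max-min problem, then, at almost every frequency, $$\mathcal L_\gamma^*\mathcal L_\gamma=\max\left\{\frac{\{\Delta\mathcal K_\circ\mathcal L_\gamma\}_-^*\{\Delta\mathcal K_\circ\mathcal L_\gamma\}_-}{\gamma^2-\mathcal T_{\mathcal K_\circ}^*\mathcal T_{\mathcal K_\circ}},\ 1\right\}.\qquad(*)$$ 3. If $\mathcal K_2$ is an optimal $H_2$ controller (a minimiser of $\operatorname{tr}(\mathcal T_{\mathcal K}^*\mathcal T_{\mathcal K})$ over the controllers $\mathcal K\in\mathcal H_\infty$), then $(\mathcal K_\gamma,\Lambda_\gamma)$ is a saddle point if and only if $(*)$ holds and $\mathcal K_\gamma=\mathcal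 K_2+\Delta^{-1}\big\{\{\Delta\mathcal K_\circ\}_-\mathcal L_\gamma\big\}_+\mathcal L_\gamma^{-1}$. -/

import Mathlib

open MeasureTheory
open scoped Real ENNReal Matrix ComplexConjugate

noncomputable section

namespace MixedControl

/-- Frequencies `ω ∈ ℝ / 2πℤ`. The unit circle is parametrised by `ω ↦ exp (i ω)`, that is, by
`fourier 1`. -/
abbrev Freq : Type := AddCircle (2 * π)

instance factTwoPi : Fact (0 < 2 * π) := ⟨Real.two_pi_pos⟩

/-- The normalised Lebesgue measure `dω / 2π`. -/
abbrev freqMeasure : Measure Freq := AddCircle.haarAddCircle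

/-- The column vectors `ℂ^ι` with the Euclidean norm. -/
abbrev CVec (ι : Type) [Fintype ι] : Type := EuclideanSpace ℂ ι

/-- Matrix times vector, for Euclidean vectors. -/
def act {ι κ : Type} [Fintype ι] [Fintype κ] (M : Matrix ι κ ℂ) (v : CVec κ) : CVec ι :=
  WithLp.toLp 2 (M *ᵥ v.ofLp)

/-! ### Laurent operators

A (block) Laurent operator is represented by its symbol, a function of the frequency. -/

section Laurent

variable {E : Type} [NormedAddCommGroup E] [NormedSpace ℂ E]

/-- The Markov parameters `M̂_t` of a symbol `M`, so that `M(e^{iω}) = ∑_t M̂_t e^{-iωt}`. -/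
def markov (M : Freq → E) (t : ℤ) : E := fourierCoeff M (-t)

/-- `M` is causal: its Markov parameters vanish at negative times. -/
def IsCausal (M : Freq → E) : Prop := ∀ t : ℤ, t < 0 → markov M t = 0

/-- The space `H_p` of causal operators whose symbol has a finite `L_p` norm on the circle. -/
def MemHardy (p : ℝ≥0∞) (M : Freq → E) : Prop := MemLp M p freqMeasure ∧ IsCausal M

end Laurent

/-- The causal part of a scalar symbol, `∑_{t ≥ 0} M̂_t e^{-iωt}` (the sum taken in `L²`). -/
def causalPartScalar (M : Freq → ℂ) : Freq → ℂ :=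
  ((∑' k : ℕ, markov M k • fourierLp 2 (-(k : ℤ)) : Lp ℂ 2 freqMeasure) : Freq → ℂ)

/-- The strictly anticausal part of a scalar symbol, `∑_{t < 0} M̂_t e^{-iωt}`
(the sum taken in `L²`). -/
def anticausalPartScalar (M : Freq → ℂ) : Freq → ℂ :=
  ((∑' k : ℕ, markov M (-((k : ℤ) + 1)) • fourierLp 2 ((k : ℤ) + 1) :
    Lp ℂ 2 freqMeasure) : Freq → ℂ)

/-- The causal part `{M}₊` of a column symbol, entry by entry. -/
def causalPart {ι : Type} [Fintype ι] (M : Freq → CVec ι) (ω : Freq) : CVec ι :=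
  WithLp.toLp 2 fun i => causalPartScalar (fun θ => M θ i) ω

/-- The strictly anticausal part `{M}₋` of a column symbol, entry by entry. -/
def anticausalPart {ι : Type} [Fintype ι] (M : Freq → CVec ι) (ω : Freq) : CVec ι :=
  WithLp.toLp 2 fun i => anticausalPartScalar (fun θ => M θ i) ω

/-! ### The system, its controllers, and the closed loop -/

/-- The data of `x_{t+1} = A x_t + B_u u_t + B_w w_t` with scalar disturbances `w_t`, together with
the matrix `C` that forms the regulated output `C x_t` (`C = 1` for the stage cost
`‖x_t‖² + ‖u_t‖²`). -/
structure LTISystem (dx du ds : ℕ) where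
  A : Matrix (Fin dx) (Fin dx) ℝ
  Bu : Matrix (Fin dx) (Fin du) ℝ
  Bw : Fin dx → ℝ
  C : Matrix (Fin ds) (Fin dx) ℝ

/-- Causal and bounded controllers with a scalar disturbance: the real elements of
`H_∞^{du × 1}`. -/
def IsController {du : ℕ} (K : Freq → CVec (Fin du)) : Prop :=
  MemHardy ∞ K ∧ ∀ (t : ℤ) (i : Fin du), (markov K t i).im = 0

/-- The dual variables: positive semidefinite self-adjoint scalar real Laurent operators in
`L_1`. -/
def IsDualVariable (Λ : Freq → ℝ) : Prop :=
  Integrable Λ freqMeasure ∧ (∀ᵐ ω ∂freqMeasure, 0 ≤ Λ ω) ∧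
    ∀ t : ℤ, (markov (fun ω => (Λ ω : ℂ)) t).im = 0

/-- `L` is a causal and causally invertible spectral factor of the scalar operator `I + Λ`,
`L L^* = I + Λ`. (As `Λ ≥ 0`, the inverse is automatically bounded by one.) -/
def IsSpectralFactor (Λ : Freq → ℝ) (L : Freq → ℂ) : Prop :=
  MemHardy 2 L ∧ IsCausal (fun ω => (L ω)⁻¹) ∧
    ∀ᵐ ω ∂freqMeasure, L ω * conj (L ω) = ((1 + Λ ω : ℝ) : ℂ)

namespace LTISystem

variable {dx du ds : ℕ} (P : LTISystem dx du ds)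

/-- The resolvent `(zI - A)⁻¹` at `z = e^{iω}`. -/
def resolvent (ω : Freq) : Matrix (Fin dx) (Fin dx) ℂ :=
  ((fourier 1 ω : ℂ) • (1 : Matrix (Fin dx) (Fin dx) ℂ) - P.A.map Complex.ofReal)⁻¹

/-- `F(e^{iω}) = C (e^{iω} I - A)⁻¹ B_u`. -/
def F (ω : Freq) : Matrix (Fin ds) (Fin du) ℂ :=
  P.C.map Complex.ofReal * P.resolvent ω * P.Bu.map Complex.ofReal

/-- `G(e^{iω}) = C (e^{iω} I - A)⁻¹ B_w`. -/
def G (ω : Freq) : CVec (Fin ds) :=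
  WithLp.toLp 2 ((P.C.map Complex.ofReal * P.resolvent ω) *ᵥ fun i => (P.Bw i : ℂ))

/-- The closed-loop symbol `T_K = [F K + G; K]`. As it is a single column,
`T_K(e^{iω})^* T_K(e^{iω}) = ‖T_K(e^{iω})‖²`. -/
def closedLoop (K : Freq → CVec (Fin du)) (ω : Freq) : CVec (Fin ds ⊕ Fin du) :=
  WithLp.toLp 2 (Sum.elim (act (P.F ω) (K ω) + P.G ω).ofLp (K ω).ofLp)

/-- The non-causal controller `K_∘ = -(I + F^* F)⁻¹ F^* G`. -/
def noncausal (ω : Freq) : CVec (Fin du) :=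
  -act ((1 + (P.F ω)ᴴ * P.F ω)⁻¹ * (P.F ω)ᴴ) (P.G ω)

/-- The `H_∞` norm of `T_K`, the essential supremum of `‖T_K(e^{iω})‖`. -/
def opNorm (K : Freq → CVec (Fin du)) : ℝ≥0∞ := eLpNorm (P.closedLoop K) ∞ freqMeasure

/-- The `H_2` norm of `T_K`. -/
def hsNorm (K : Freq → CVec (Fin du)) : ℝ≥0∞ := eLpNorm (P.closedLoop K) 2 freqMeasure

/-- `γ_∞`, the least closed-loop `H_∞` norm over causal bounded controllers. -/
def gammaInf : ℝ≥0∞ := ⨅ (K : Freq → CVec (Fin du)) (_ : IsController K), P.opNorm K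

/-- `K` is an optimal `H_2` controller. -/
def IsH2Optimal (K : Freq → CVec (Fin du)) : Prop :=
  IsController K ∧ ∀ K', IsController K' → P.hsNorm K ≤ P.hsNorm K'

/-- The Lagrangian `tr (T_K^* T_K (I + Λ)) - γ² tr Λ`. -/
def lagrangian (γ : ℝ) (K : Freq → CVec (Fin du)) (Λ : Freq → ℝ) : ℝ :=
  (∫ ω, ‖P.closedLoop K ω‖ ^ 2 * (1 + Λ ω) ∂freqMeasure) - γ ^ 2 * ∫ ω, Λ ω ∂freqMeasure

/-- `(K, Λ)` is a saddle point of `max_{Λ ≥ 0} min_K tr (T_K^* T_K (I + Λ)) - γ² tr Λ`. -/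
def IsSaddlePoint (γ : ℝ) (K : Freq → CVec (Fin du)) (Λ : Freq → ℝ) : Prop :=
  IsController K ∧ IsDualVariable Λ ∧
    (∀ K', IsController K' → P.lagrangian γ K Λ ≤ P.lagrangian γ K' Λ) ∧
    (∀ Λ', IsDualVariable Λ' → P.lagrangian γ K Λ' ≤ P.lagrangian γ K Λ)

/-- `Δ` is a causal and causally invertible spectral factor of `I + F^* F`,
`Δ^* Δ = I + F^* F`. -/
def IsPlantFactor (Δ : Freq → Matrix (Fin du) (Fin du) ℂ) : Prop :=
  (∀ i j, MemHardy ∞ fun ω => Δ ω i j) ∧ (∀ i j, MemHardy ∞ fun ω => (Δ ω)⁻¹ i j) ∧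
    ∀ᵐ ω ∂freqMeasure, (Δ ω)ᴴ * Δ ω = 1 + (P.F ω)ᴴ * P.F ω

/-- `S = {Δ K_∘ L}₋`. -/
def S (Δ : Freq → Matrix (Fin du) (Fin du) ℂ) (L : Freq → ℂ) : Freq → CVec (Fin du) :=
  anticausalPart fun ω => L ω • act (Δ ω) (P.noncausal ω)

/-- The controller `K₂ + Δ⁻¹ {{Δ K_∘}₋ L}₊ L⁻¹`. -/
def wienerHopf (K₂ : Freq → CVec (Fin du)) (Δ : Freq → Matrix (Fin du) (Fin du) ℂ)
    (L : Freq → ℂ) (ω : Freq) : CVec (Fin du) :=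
  K₂ ω + (L ω)⁻¹ • act (Δ ω)⁻¹
    (causalPart (fun θ => L θ • anticausalPart (fun η => act (Δ η) (P.noncausal η)) θ) ω)

/-- The scalar optimality condition
`L^* L = max {{Δ K_∘ L}₋^* {Δ K_∘ L}₋ / (γ² - T_{K_∘}^* T_{K_∘}), 1}`, at almost every
frequency. -/
def ScalarCondition (γ : ℝ) (Δ : Freq → Matrix (Fin du) (Fin du) ℂ) (L : Freq → ℂ) : Prop :=
  ∀ᵐ ω ∂freqMeasure,
    ‖L ω‖ ^ 2 = max (‖P.S Δ L ω‖ ^ 2 / (γ ^ 2 - ‖P.closedLoop P.noncausal ω‖ ^ 2)) 1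

end LTISystem

end MixedControl

end

/-!
The cost of a controller splits pointwise by completion of squares,
`‖T_K‖² = ‖T_{K_∘}‖² + ‖Δ (K - K_∘)‖²`. In particular `‖T_{K_∘}‖ ≤ ‖T_K‖` for every `K`, and a
controller with `‖T_K‖_∞ < γ` gives the gap `γ² - ‖T_{K_∘}‖² ≥ ε`.

The two halves of the saddle point condition are then characterised separately. For fixed `Λ`, with
`|L|² = 1 + Λ`, the controller minimises the `L²` distance from `Δ K L` to `Δ K_∘ L`. The function
`Δ K L` is causal, and since `Δ⁻¹` and `L⁻¹` are causal and bounded the admissible directions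
`Δ H L` include all polynomials; hence `K` is a minimiser exactly when `Δ (K_∘ - K) L` is the
strictly anticausal part `S` of `Δ K_∘ L` (`forall_lagrangian_le_iff`). Controllers have real Markov
parameters whereas `Δ` and `L` need not, so this uses that `F`, `G`, `K` and `Λ` are symmetric under
`ω ↦ -ω` together with complex conjugation: the first variation then vanishes in complex directions
too (`integral_inner_eq_zero_of_minimal`). For fixed `K`, maximality of `Λ` is complementary
slackness: `‖T_K‖ ≤ γ`, with equality wherever `Λ > 0` (`forall_le_lagrangian_iff`).

Together these say `‖T_K‖² = ‖T_{K_∘}‖² + ‖S‖² / |L|²`, which is at most `γ²`, with equality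
wherever `|L|² > 1`; this is the scalar condition (`scalarCondition_iff`). Finally an optimal `H_2`
controller is the case `Λ = 0`, `L = 1`, so `{Δ K_∘}₋ = Δ (K_∘ - K₂)`, and the formula for `K_γ`
solves `Δ (K_∘ - K) L = S` (`ae_eq_wienerHopf_iff`).
-/

noncomputable section

namespace MixedControl

open Filter Topology

/-! ### Markov parameters and Parseval's formula -/

theorem markov_eq_integral (f : Freq → ℂ) (t : ℤ) :
    markov f t = ∫ ω, fourier t ω * f ω ∂freqMeasure := by
  simp [markov, fourierCoeff]

theorem markov_congr {f g : Freq → ℂ} (h : f =ᵐ[freqMeasure] g) (t : ℤ) :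
    markov f t = markov g t := by
  simp only [markov, fourierCoeff_congr_ae h]

theorem integrable_fourier_mul {f : Freq → ℂ} (hf : Integrable f freqMeasure) (t : ℤ) :
    Integrable (fun ω => fourier t ω * f ω) freqMeasure := by
  simpa using hf.fourier_smul t

theorem memLp_fourier (t : ℤ) (p : ℝ≥0∞) : MemLp (fun ω : Freq => fourier t ω) p freqMeasure :=
  MemLp.of_bound (fourier t).continuous.aestronglyMeasurable 1
    (ae_of_all _ fun ω => by rw [fourier_apply, Circle.norm_coe])

theorem memLp_fourier_mul {p : ℝ≥0∞} {f : Freq → ℂ} (hf : MemLp f p freqMeasure) (t : ℤ) :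
    MemLp (fun ω => fourier t ω * f ω) p freqMeasure :=
  hf.mul' (memLp_fourier t ∞)

theorem markov_add {f g : Freq → ℂ} (hf : Integrable f freqMeasure) (hg : Integrable g freqMeasure)
    (t : ℤ) : markov (fun ω => f ω + g ω) t = markov f t + markov g t := by
  simp only [markov_eq_integral, mul_add]
  exact integral_add (integrable_fourier_mul hf t) (integrable_fourier_mul hg t)

theorem markov_sub {f g : Freq → ℂ} (hf : Integrable f freqMeasure) (hg : Integrable g freqMeasure)
    (t : ℤ) : markov (fun ω => f ω - g ω) t = markov f t - markov g t := by
  simp only [markov_eq_integral, mul_sub]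
  exact integral_sub (integrable_fourier_mul hf t) (integrable_fourier_mul hg t)

theorem markov_const_mul (c : ℂ) (f : Freq → ℂ) (t : ℤ) :
    markov (fun ω => c * f ω) t = c * markov f t := by
  simp only [markov, fourierCoeff.const_mul]

theorem markov_fourier_mul (f : Freq → ℂ) (s t : ℤ) :
    markov (fun ω => fourier s ω * f ω) t = markov f (t + s) := by
  simp only [markov_eq_integral, fourier_add, mul_assoc]

theorem markov_fourier (s t : ℤ) :
    markov (fun ω : Freq => (fourier s ω : ℂ)) t = if t = -s then 1 else 0 := by
  have := congrFun (fourierCoeff_fourier (T := 2 * π) s) (-t)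
  rw [markov]
  refine this.trans ?_
  by_cases h : t = -s
  · simp [h]
  · rw [if_neg h, Pi.single_eq_of_ne]
    omega

theorem markov_conj (f : Freq → ℂ) (t : ℤ) :
    markov (fun ω => conj (f ω)) t = conj (markov f (-t)) := by
  simp only [markov_eq_integral, ← integral_conj, map_mul, ← fourier_neg, neg_neg]

/-- Replacing `ω` by `-ω` reverses time. -/
theorem markov_comp_neg (f : Freq → ℂ) (t : ℤ) :
    markov (fun ω => f (-ω)) t = markov f (-t) := by
  simp only [markov_eq_integral]
  rw [← integral_neg_eq_self]
  simp [fourier_apply]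

/-- An integrable function on the circle with vanishing Fourier coefficients is null: its
integrals against trigonometric polynomials vanish, hence those against continuous functions, hence
those over closed sets. -/
theorem ae_eq_zero_of_markov_eq_zero {f : Freq → ℂ} (hf : Integrable f freqMeasure)
    (h : ∀ t, markov f t = 0) : f =ᵐ[freqMeasure] 0 := by
  have hint : ∀ g : C(Freq, ℂ), Integrable (fun ω => g ω * f ω) freqMeasure := fun g =>
    hf.bdd_mul g.continuous.aestronglyMeasurable (ae_of_all _ g.norm_coe_le_norm)
  -- `g ↦ ∫ g f` is continuous in the supremum norm, so its kernel is closed.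
  have hcont : ∀ g : C(Freq, ℂ), ∫ ω, g ω * f ω ∂freqMeasure = 0 := by
    let φ : C(Freq, ℂ) →L[ℂ] ℂ := LinearMap.mkContinuous
      { toFun := fun g => ∫ ω, g ω * f ω ∂freqMeasure
        map_add' := fun g g' => by
          simp only [ContinuousMap.add_apply, add_mul]
          exact integral_add (hint g) (hint g')
        map_smul' := fun c g => by
          simp only [ContinuousMap.smul_apply, smul_eq_mul, mul_assoc, RingHom.id_apply]
          exact integral_const_mul c _ }
      (∫ ω, ‖f ω‖ ∂freqMeasure) fun g => by
        rw [mul_comm (∫ ω, ‖f ω‖ ∂freqMeasure), ← integral_const_mul]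
        refine norm_integral_le_of_norm_le (hf.norm.const_mul _) (ae_of_all _ fun ω => ?_)
        rw [norm_mul]
        exact mul_le_mul_of_nonneg_right (g.norm_coe_le_norm ω) (norm_nonneg _)
    have hker : (⊤ : Submodule ℂ C(Freq, ℂ)) ≤ φ.ker := by
      rw [← span_fourier_closure_eq_top]
      refine Submodule.topologicalClosure_minimal _ (Submodule.span_le.2 ?_) φ.isClosed_ker
      rintro _ ⟨t, rfl⟩
      exact (markov_eq_integral f t).symm.trans (h t)
    exact fun g => hker (Submodule.mem_top (x := g))
  refine ae_eq_zero_of_forall_setIntegral_isClosed_eq_zero hf fun s hs => ?_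
  have hδ : ∀ n : ℕ, (0 : ℝ) < 1 / ((n : ℝ) + 1) := fun n => Nat.one_div_pos_of_nat
  have hlim := thickenedIndicator_tendsto_indicator_closure hδ
    tendsto_one_div_add_atTop_nhds_zero_nat s
  rw [hs.closure_eq, tendsto_pi_nhds] at hlim
  have key : Tendsto (fun n => ∫ ω, ((thickenedIndicator (hδ n) s ω : ℝ) : ℂ) * f ω ∂freqMeasure)
      atTop (𝓝 (∫ ω, s.indicator f ω ∂freqMeasure)) := by
    refine tendsto_integral_of_dominated_convergence (fun ω => ‖f ω‖) (fun n => ?_) hf.norm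
      (fun n => ae_of_all _ fun ω => ?_) (ae_of_all _ fun ω => ?_)
    · exact (Continuous.aestronglyMeasurable (by fun_prop)).mul hf.1
    · rw [norm_mul]
      refine mul_le_of_le_one_left (norm_nonneg _) ?_
      simpa using thickenedIndicator_le_one (hδ n) s ω
    · have h1 : Tendsto (fun n => ((thickenedIndicator (hδ n) s ω : ℝ) : ℂ)) atTop
          (𝓝 (((s.indicator (fun _ => (1 : NNReal)) ω : NNReal) : ℝ) : ℂ)) :=
        (Complex.continuous_ofReal.tendsto _).comp
          ((NNReal.continuous_coe.tendsto _).comp (hlim ω))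
      have h2 := h1.mul_const (f ω)
      by_cases hω : ω ∈ s <;> simpa [hω] using h2
  rw [← integral_indicator hs.measurableSet]
  refine tendsto_nhds_unique key ?_
  have h0 : ∀ n, ∫ ω, ((thickenedIndicator (hδ n) s ω : ℝ) : ℂ) * f ω ∂freqMeasure = 0 := fun n =>
    hcont ⟨fun ω => ((thickenedIndicator (hδ n) s ω : ℝ) : ℂ), by fun_prop⟩
  simp only [h0]
  exact tendsto_const_nhds

theorem ae_eq_of_markov_eq {f g : Freq → ℂ} (hf : Integrable f freqMeasure)
    (hg : Integrable g freqMeasure) (h : ∀ t, markov f t = markov g t) : f =ᵐ[freqMeasure] g := by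
  filter_upwards [ae_eq_zero_of_markov_eq_zero (hf.sub hg) fun t => by
    rw [show f - g = fun ω => f ω - g ω from rfl, markov_sub hf hg, h, sub_self]] with ω hω
  exact sub_eq_zero.1 hω

/-- A symbol with real Markov parameters is conjugated by `ω ↦ -ω`. -/
theorem ae_comp_neg_eq_conj {f : Freq → ℂ} (hf : Integrable f freqMeasure)
    (h : ∀ t, (markov f t).im = 0) : ∀ᵐ ω ∂freqMeasure, f (-ω) = conj (f ω) := by
  refine ae_eq_of_markov_eq hf.comp_neg
    ((RCLike.conjLIE (K := ℂ)).toContinuousLinearEquiv.integrable_comp_iff.2 hf) fun t => ?_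
  rw [markov_comp_neg]
  exact (Complex.conj_eq_iff_im.2 (h (-t))).symm.trans (markov_conj f t).symm

theorem markov_im_eq_zero {f : Freq → ℂ} (h : ∀ᵐ ω ∂freqMeasure, f (-ω) = conj (f ω)) (t : ℤ) :
    (markov f t).im = 0 := by
  rw [← Complex.conj_eq_iff_im, ← neg_neg t, ← markov_conj, ← markov_congr h, markov_comp_neg]

/-- Parseval's formula in bilinear form. -/
theorem hasSum_markov_mul {f g : Freq → ℂ} (hf : MemLp f 2 freqMeasure)
    (hg : MemLp g 2 freqMeasure) :
    HasSum (fun t => markov f t * markov g (-t)) (∫ ω, f ω * g ω ∂freqMeasure) := by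
  have hf' : MemLp (fun ω => conj (f ω)) 2 freqMeasure := hf.star
  have h := fourierBasis.hasSum_inner_mul_inner (hf'.toLp _) (hg.toLp _)
  have h1 : ∀ t, inner ℂ (hf'.toLp _) (fourierBasis t) = markov f t := fun t => by
    rw [← inner_conj_symm, ← HilbertBasis.repr_apply_apply, fourierBasis_repr,
      fourierCoeff_congr_ae hf'.coeFn_toLp]
    have := markov_conj f (-t)
    rw [neg_neg] at this
    rw [← Complex.conj_conj (markov f t), ← this, markov, neg_neg]
  have h2 : ∀ t, inner ℂ (fourierBasis t) (hg.toLp _) = markov g (-t) := fun t => by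
    rw [← HilbertBasis.repr_apply_apply, fourierBasis_repr,
      fourierCoeff_congr_ae hg.coeFn_toLp, markov, neg_neg]
  simp only [h1, h2] at h
  rw [L2.inner_def] at h
  refine (integral_congr_ae ?_ : _ = ∫ ω, f ω * g ω ∂freqMeasure) ▸ h
  filter_upwards [hf'.coeFn_toLp, hg.coeFn_toLp] with ω h1 h2
  rw [h1, h2]
  simp [mul_comm]

theorem integral_mul_eq_zero {f g : Freq → ℂ} (hf : MemLp f 2 freqMeasure)
    (hg : MemLp g 2 freqMeasure) (h : ∀ t, markov f t = 0 ∨ markov g (-t) = 0) :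
    ∫ ω, f ω * g ω ∂freqMeasure = 0 := by
  refine (hasSum_markov_mul hf hg).unique ?_
  simp only [mul_eq_zero.2 (h _)]
  exact hasSum_zero

theorem isCausal_mul {f g : Freq → ℂ} (hf : MemLp f 2 freqMeasure) (hg : MemLp g 2 freqMeasure)
    (hfc : IsCausal f) (hgc : IsCausal g) : IsCausal fun ω => f ω * g ω := by
  intro t ht
  rw [markov_eq_integral]
  simp only [← mul_assoc]
  refine integral_mul_eq_zero (memLp_fourier_mul hf t) hg fun s => ?_
  rw [markov_fourier_mul]
  rcases lt_or_ge (s + t) 0 with h | h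
  · exact Or.inl (hfc _ h)
  · exact Or.inr (hgc _ (by omega))

/-- Causal and strictly anticausal square-integrable symbols are orthogonal. -/
theorem integral_conj_mul_eq_zero {f g : Freq → ℂ} (hf : MemLp f 2 freqMeasure)
    (hg : MemLp g 2 freqMeasure) (hfc : IsCausal f) (hgc : ∀ t, 0 ≤ t → markov g t = 0) :
    ∫ ω, conj (f ω) * g ω ∂freqMeasure = 0 := by
  refine integral_mul_eq_zero hf.star hg fun t => ?_
  rcases lt_or_ge (-t) 0 with h | h
  · left
    exact (markov_conj f t).trans (by rw [hfc _ h, map_zero])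
  · exact Or.inr (hgc _ h)

/-! ### Causal and strictly anticausal parts -/

section Parts

variable {f : Freq → ℂ}

theorem hasSum_markov_smul (hf : MemLp f 2 freqMeasure) :
    HasSum (fun n : ℤ => markov f (-n) • fourierLp (T := 2 * π) 2 n) (hf.toLp f) := by
  have h := hasSum_fourier_series_L2 (hf.toLp f)
  simpa only [fourierCoeff_congr_ae hf.coeFn_toLp, markov, neg_neg] using h

theorem summable_causal (hf : MemLp f 2 freqMeasure) :
    Summable fun k : ℕ => markov f k • fourierLp (T := 2 * π) 2 (-(k : ℤ)) := by
  have h := (hasSum_markov_smul hf).summable.comp_injective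
    (i := fun k : ℕ => -(k : ℤ)) fun a b h => by simpa using h
  simpa [Function.comp_def] using h

theorem summable_anticausal (hf : MemLp f 2 freqMeasure) :
    Summable fun k : ℕ => markov f (-((k : ℤ) + 1)) • fourierLp (T := 2 * π) 2 ((k : ℤ) + 1) :=
  (hasSum_markov_smul hf).summable.comp_injective
    (i := fun k : ℕ => (k : ℤ) + 1) fun a b h => by simpa using h

theorem memLp_causalPartScalar : MemLp (causalPartScalar f) 2 freqMeasure := Lp.memLp _

theorem memLp_anticausalPartScalar : MemLp (anticausalPartScalar f) 2 freqMeasure := Lp.memLp _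

theorem markov_lp (F : Lp ℂ 2 (freqMeasure)) (t : ℤ) :
    markov F t = inner ℂ (fourierLp (T := 2 * π) 2 (-t)) F := by
  rw [markov, ← fourierBasis_repr, HilbertBasis.repr_apply_apply, coe_fourierBasis]

theorem causalPartScalar_isCausal (hf : MemLp f 2 freqMeasure) : IsCausal (causalPartScalar f) := by
  intro t ht
  rw [causalPartScalar, markov_lp]
  refine ((summable_causal hf).hasSum.mapL (innerSL ℂ _)).unique ?_
  convert hasSum_zero with k
  rw [innerSL_apply_apply, inner_smul_right, orthonormal_fourier.2 (by omega), mul_zero]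

theorem markov_anticausalPartScalar (hf : MemLp f 2 freqMeasure) {t : ℤ} (ht : 0 ≤ t) :
    markov (anticausalPartScalar f) t = 0 := by
  rw [anticausalPartScalar, markov_lp]
  refine ((summable_anticausal hf).hasSum.mapL (innerSL ℂ _)).unique ?_
  convert hasSum_zero with k
  rw [innerSL_apply_apply, inner_smul_right, orthonormal_fourier.2 (by omega), mul_zero]

theorem causalPartScalar_add_anticausalPartScalar (hf : MemLp f 2 freqMeasure) :
    ∀ᵐ ω ∂freqMeasure, causalPartScalar f ω + anticausalPartScalar f ω = f ω := by
  have h : HasSum (fun n : ℤ => markov f n • fourierLp (T := 2 * π) 2 (-n)) (hf.toLp f) := by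
    simpa [Function.comp_def] using (Equiv.neg ℤ).hasSum_iff.2 (hasSum_markov_smul hf)
  have h' : HasSum (fun n : ℤ => markov f n • fourierLp (T := 2 * π) 2 (-n)) _ :=
    HasSum.of_nat_of_neg_add_one (summable_causal hf).hasSum
      (by simpa only [neg_neg] using (summable_anticausal hf).hasSum)
  have h3 := h'.unique h
  filter_upwards [Lp.coeFn_add (∑' k : ℕ, markov f k • fourierLp (T := 2 * π) 2 (-(k : ℤ)))
    (∑' k : ℕ, markov f (-((k : ℤ) + 1)) • fourierLp (T := 2 * π) 2 ((k : ℤ) + 1)),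
    hf.coeFn_toLp] with ω h1 h2
  rw [causalPartScalar, anticausalPartScalar, ← h2, ← h3, h1, Pi.add_apply]

/-- Uniqueness of the splitting into a causal and a strictly anticausal part. -/
theorem ae_eq_anticausalPartScalar {p q : Freq → ℂ} (hf : MemLp f 2 freqMeasure)
    (hp : MemLp p 2 freqMeasure) (hq : MemLp q 2 freqMeasure) (hpc : IsCausal p)
    (hqc : ∀ t, 0 ≤ t → markov q t = 0) (h : ∀ᵐ ω ∂freqMeasure, f ω = p ω + q ω) :
    q =ᵐ[freqMeasure] anticausalPartScalar f := by
  have one_le : (1 : ℝ≥0∞) ≤ 2 := by norm_num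
  have hpi := hp.integrable one_le
  have hqi := hq.integrable one_le
  have hc := (memLp_causalPartScalar (f := f)).integrable one_le
  have ha := (memLp_anticausalPartScalar (f := f)).integrable one_le
  refine ae_eq_of_markov_eq hqi ha fun t => ?_
  rcases lt_or_ge t 0 with ht | ht
  · have h1 : markov f t = markov p t + markov q t := by rw [markov_congr h, markov_add hpi hqi]
    have h2 := markov_congr (causalPartScalar_add_anticausalPartScalar hf) t
    rw [markov_add hc ha, causalPartScalar_isCausal hf t ht, h1, hpc t ht] at h2
    simpa using h2.symm
  · rw [hqc t ht, markov_anticausalPartScalar hf ht]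

end Parts

/-! ### Pointwise algebra of the closed loop -/

section Act

variable {ι κ ν : Type} [Fintype ι] [Fintype κ] [Fintype ν]

theorem act_add (M : Matrix ι κ ℂ) (v w : CVec κ) : act M (v + w) = act M v + act M w := by
  simp [act, Matrix.mulVec_add]

theorem act_sub (M : Matrix ι κ ℂ) (v w : CVec κ) : act M (v - w) = act M v - act M w := by
  simp [act, Matrix.mulVec_sub]

theorem act_smul (M : Matrix ι κ ℂ) (c : ℂ) (v : CVec κ) : act M (c • v) = c • act M v := by
  simp [act, Matrix.mulVec_smul]

theorem act_neg (M : Matrix ι κ ℂ) (v : CVec κ) : act M (-v) = -act M v := by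
  simp [act, Matrix.mulVec_neg]

theorem act_one [DecidableEq ι] (v : CVec ι) : act 1 v = v := by
  simp [act]

theorem act_mul (M : Matrix ι κ ℂ) (N : Matrix κ ν ℂ) (v : CVec ν) :
    act (M * N) v = act M (act N v) := by
  simp [act, Matrix.mulVec_mulVec]

theorem add_act (M N : Matrix ι κ ℂ) (v : CVec κ) : act (M + N) v = act M v + act N v := by
  simp [act, Matrix.add_mulVec]

theorem act_apply (M : Matrix ι κ ℂ) (v : CVec κ) (i : ι) : act M v i = ∑ j, M i j * v j := rfl

theorem inner_act_right (M : Matrix ι κ ℂ) (v : CVec ι) (w : CVec κ) :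
    inner ℂ v (act M w) = inner ℂ (act Mᴴ v) w := by
  simp only [EuclideanSpace.inner_eq_star_dotProduct, act, Matrix.star_mulVec,
    Matrix.conjTranspose_conjTranspose]
  rw [dotProduct_comm, Matrix.dotProduct_mulVec, dotProduct_comm]

theorem inner_act_act (M : Matrix ι κ ℂ) (v w : CVec κ) :
    inner ℂ (act M v) (act M w) = inner ℂ v (act (Mᴴ * M) w) := by
  rw [act_mul, inner_act_right Mᴴ, Matrix.conjTranspose_conjTranspose]

/-- Entrywise complex conjugation of a vector. -/
def conjVec (v : CVec ι) : CVec ι := WithLp.toLp 2 fun i => conj (v i)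

@[simp] theorem conjVec_apply (v : CVec ι) (i : ι) : conjVec v i = conj (v i) := rfl

theorem inner_conjVec (v w : CVec ι) :
    inner ℂ (conjVec v) (conjVec w) = conj (inner ℂ v w) := by
  simp [PiLp.inner_apply]

theorem norm_conjVec (v : CVec ι) : ‖conjVec v‖ = ‖v‖ := by
  simp [EuclideanSpace.norm_eq]

end Act

namespace LTISystem

variable {dx du ds : ℕ} (P : LTISystem dx du ds)

/-- The output `[F h; h]` of the closed loop due to the control `h` alone. -/
def controlOutput (h : CVec (Fin du)) (ω : Freq) : CVec (Fin ds ⊕ Fin du) :=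
  WithLp.toLp 2 (Sum.elim (act (P.F ω) h).ofLp h.ofLp)

theorem closedLoop_sub (K K' : Freq → CVec (Fin du)) (ω : Freq) :
    P.closedLoop K' ω = P.closedLoop K ω + P.controlOutput (K' ω - K ω) ω := by
  ext (i | i) <;> simp [closedLoop, controlOutput, act_sub]
  ring

theorem controlOutput_smul (c : ℂ) (h : CVec (Fin du)) (ω : Freq) :
    P.controlOutput (c • h) ω = c • P.controlOutput h ω := by
  ext (i | i) <;> simp [controlOutput, act_smul]

theorem controlOutput_add (h h' : CVec (Fin du)) (ω : Freq) :
    P.controlOutput (h + h') ω = P.controlOutput h ω + P.controlOutput h' ω := by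
  ext (i | i) <;> simp [controlOutput, act_add]

open scoped ComplexOrder in
theorem isUnit_det_gram (ω : Freq) : IsUnit (1 + (P.F ω)ᴴ * P.F ω).det :=
  (Matrix.PosDef.one.add_posSemidef
    (Matrix.posSemidef_conjTranspose_mul_self (P.F ω))).det_pos.ne'.isUnit

theorem inner_sumElim {ι κ : Type} [Fintype ι] [Fintype κ] (a c : CVec ι) (b d : CVec κ) :
    inner ℂ (WithLp.toLp 2 (Sum.elim a.ofLp b.ofLp) : CVec (ι ⊕ κ))
      (WithLp.toLp 2 (Sum.elim c.ofLp d.ofLp)) = inner ℂ a c + inner ℂ b d := by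
  simp [PiLp.inner_apply]

/-- Completion of squares in polarised form. -/
theorem inner_controlOutput_closedLoop_gram (K : Freq → CVec (Fin du)) (h : CVec (Fin du))
    (ω : Freq) :
    inner ℂ (P.controlOutput h ω) (P.closedLoop K ω) =
      inner ℂ h (act (1 + (P.F ω)ᴴ * P.F ω) (K ω - P.noncausal ω)) := by
  have hF : ∀ w, inner ℂ h (act (P.F ω)ᴴ w) = inner ℂ (act (P.F ω) h) w := fun w => by
    rw [inner_act_right, Matrix.conjTranspose_conjTranspose]
  rw [controlOutput, closedLoop, inner_sumElim, noncausal, sub_neg_eq_add, act_add,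
    ← act_mul (1 + _), ← Matrix.mul_assoc, Matrix.mul_nonsing_inv _ (P.isUnit_det_gram ω),
    Matrix.one_mul, add_act, act_one, act_mul, inner_add_right, inner_add_right, inner_add_right,
    hF, hF]
  ring

theorem norm_sq_closedLoop_noncausal_le (K : Freq → CVec (Fin du)) (ω : Freq) :
    ‖P.closedLoop P.noncausal ω‖ ^ 2 ≤ ‖P.closedLoop K ω‖ ^ 2 := by
  have h := P.inner_controlOutput_closedLoop_gram P.noncausal (K ω - P.noncausal ω) ω
  rw [sub_self, show act (1 + (P.F ω)ᴴ * P.F ω) 0 = 0 by simp [act], inner_zero_right] at h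
  rw [P.closedLoop_sub P.noncausal K, @norm_add_sq ℂ, ← inner_conj_symm, h]
  simp

section Factor

variable {P} {D : Matrix (Fin du) (Fin du) ℂ} {ω : Freq}

theorem isUnit_det_of_conjTranspose_mul_self (hD : Dᴴ * D = 1 + (P.F ω)ᴴ * P.F ω) :
    IsUnit D.det := by
  have h := P.isUnit_det_gram ω
  rw [← hD, Matrix.det_mul] at h
  exact isUnit_of_mul_isUnit_right h

theorem inner_controlOutput_closedLoop (hD : Dᴴ * D = 1 + (P.F ω)ᴴ * P.F ω)
    (K : Freq → CVec (Fin du)) (h : CVec (Fin du)) :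
    inner ℂ (P.controlOutput h ω) (P.closedLoop K ω) =
      inner ℂ (act D h) (act D (K ω - P.noncausal ω)) := by
  rw [inner_controlOutput_closedLoop_gram, inner_act_act, hD]

theorem norm_sq_controlOutput (hD : Dᴴ * D = 1 + (P.F ω)ᴴ * P.F ω) (h : CVec (Fin du)) :
    ‖P.controlOutput h ω‖ ^ 2 = ‖act D h‖ ^ 2 := by
  rw [← Complex.ofReal_inj, Complex.ofReal_pow, Complex.ofReal_pow]
  have h1 : inner ℂ (act D h) (act D h) = inner ℂ (P.controlOutput h ω) (P.controlOutput h ω) := by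
    rw [inner_act_act, hD, controlOutput, inner_sumElim, add_act, act_one, inner_add_right,
      ← inner_act_act, add_comm]
  simpa [inner_self_eq_norm_sq_to_K] using h1.symm

/-- Completion of squares: the excess cost of `K` over the noncausal controller. -/
theorem norm_sq_closedLoop (hD : Dᴴ * D = 1 + (P.F ω)ᴴ * P.F ω) (K : Freq → CVec (Fin du)) :
    ‖P.closedLoop K ω‖ ^ 2 =
      ‖P.closedLoop P.noncausal ω‖ ^ 2 + ‖act D (K ω - P.noncausal ω)‖ ^ 2 := by
  have h := inner_controlOutput_closedLoop hD P.noncausal (K ω - P.noncausal ω)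
  rw [sub_self, show act D 0 = 0 by simp [act], inner_zero_right] at h
  rw [P.closedLoop_sub P.noncausal K, @norm_add_sq ℂ, ← inner_conj_symm, h,
    norm_sq_controlOutput hD]
  simp

end Factor

/-! ### Regularity and symmetry of the transfer functions -/

/-- `A` has no eigenvalue on the unit circle. -/
def NoUnitEigenvalue : Prop := ∀ z : ℂ, ‖z‖ = 1 → z ∉ spectrum ℂ (P.A.map Complex.ofReal)

theorem resolvent_det_ne_zero
    (hA : P.NoUnitEigenvalue) (ω : Freq) :
    ((fourier 1 ω : ℂ) • (1 : Matrix (Fin dx) (Fin dx) ℂ) - P.A.map Complex.ofReal).det ≠ 0 := by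
  have h := hA (fourier 1 ω) (by rw [fourier_apply, Circle.norm_coe])
  rw [spectrum.notMem_iff, Algebra.algebraMap_eq_smul_one, Matrix.isUnit_iff_isUnit_det] at h
  exact h.ne_zero

theorem continuous_matrix_inv {n : Type} [Fintype n] [DecidableEq n] {M : Freq → Matrix n n ℂ}
    (hM : Continuous M) (h : ∀ ω, (M ω).det ≠ 0) : Continuous fun ω => (M ω)⁻¹ := by
  simp only [Matrix.inv_def, Ring.inverse_eq_inv']
  exact (hM.matrix_det.inv₀ h).smul hM.matrix_adjugate

theorem continuous_resolvent
    (hA : P.NoUnitEigenvalue) :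
    Continuous P.resolvent :=
  continuous_matrix_inv (((fourier 1).continuous.smul continuous_const).sub continuous_const)
    (P.resolvent_det_ne_zero hA)

theorem continuous_F (hA : P.NoUnitEigenvalue) :
    Continuous P.F :=
  (continuous_const.matrix_mul (P.continuous_resolvent hA)).matrix_mul continuous_const

theorem continuous_G (hA : P.NoUnitEigenvalue) :
    Continuous P.G :=
  (PiLp.continuous_toLp 2 _).comp
    ((continuous_const.matrix_mul (P.continuous_resolvent hA)).matrix_mulVec continuous_const)

theorem continuous_noncausal
    (hA : P.NoUnitEigenvalue) :
    Continuous P.noncausal := by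
  have hF := P.continuous_F hA
  refine Continuous.neg ((PiLp.continuous_toLp 2 _).comp (Continuous.matrix_mulVec ?_ ?_))
  · exact (continuous_matrix_inv (continuous_const.add (hF.matrix_conjTranspose.matrix_mul hF))
      fun ω => (P.isUnit_det_gram ω).ne_zero).matrix_mul hF.matrix_conjTranspose
  · exact (PiLp.continuous_ofLp 2 _).comp (P.continuous_G hA)

theorem resolvent_neg (ω : Freq) : P.resolvent (-ω) = (P.resolvent ω).map conj := by
  have h1 : (fourier 1 (-ω) : ℂ) = conj (fourier 1 ω : ℂ) := by
    rw [fourier_apply, fourier_apply, smul_neg, AddCircle.toCircle_neg, Circle.coe_inv_eq_conj]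
  have h2 : (fourier 1 (-ω) : ℂ) • (1 : Matrix (Fin dx) (Fin dx) ℂ) - P.A.map Complex.ofReal =
      ((fourier 1 ω : ℂ) • (1 : Matrix (Fin dx) (Fin dx) ℂ) - P.A.map Complex.ofReal).map conj := by
    ext i j
    rw [h1]
    by_cases hij : i = j <;> simp [hij]
  rw [resolvent, resolvent, h2, Matrix.inv_def, Matrix.inv_def, Ring.inverse_eq_inv']
  ext i j
  have h3 := RingHom.map_det (starRingEnd ℂ)
    ((fourier 1 ω : ℂ) • (1 : Matrix (Fin dx) (Fin dx) ℂ) - P.A.map Complex.ofReal)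
  rw [RingHom.mapMatrix_apply] at h3
  rw [← h3, Matrix.smul_apply, ← RingHom.mapMatrix_apply, ← RingHom.map_adjugate]
  simp

theorem F_neg (ω : Freq) : P.F (-ω) = (P.F ω).map conj := by
  ext i j
  simp [F, resolvent_neg, Matrix.mul_apply]

theorem G_neg (ω : Freq) : P.G (-ω) = conjVec (P.G ω) := by
  ext i
  simp [G, resolvent_neg, Matrix.mul_apply, Matrix.mulVec, dotProduct]

theorem closedLoop_neg {K : Freq → CVec (Fin du)} {ω : Freq} (h : K (-ω) = conjVec (K ω)) :
    P.closedLoop K (-ω) = conjVec (P.closedLoop K ω) := by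
  ext (i | i) <;> simp [closedLoop, F_neg, G_neg, h, act_apply]

theorem controlOutput_conjVec (h : CVec (Fin du)) (ω : Freq) :
    P.controlOutput (conjVec h) (-ω) = conjVec (P.controlOutput h ω) := by
  ext (i | i) <;> simp [controlOutput, F_neg, act_apply]

end LTISystem

/-! ### Hardy spaces of vector and matrix symbols -/

section Hardy

variable {ι κ : Type} [Fintype ι] [Fintype κ]

theorem memLp_of_continuous {E : Type} [NormedAddCommGroup E] [SecondCountableTopology E]
    {f : Freq → E} (hf : Continuous f) (p : ℝ≥0∞) : MemLp f p freqMeasure := by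
  obtain ⟨C, hC⟩ := (isCompact_range hf.norm).bddAbove
  exact MemLp.of_bound hf.aestronglyMeasurable C (ae_of_all _ fun ω => hC ⟨ω, rfl⟩)

theorem memLp_inner {p q r : ℝ≥0∞} [ENNReal.HolderTriple p q r] {v w : Freq → CVec ι}
    (hv : MemLp v p freqMeasure) (hw : MemLp w q freqMeasure) :
    MemLp (fun ω => inner ℂ (v ω) (w ω)) r freqMeasure :=
  MemLp.of_bilin (fun a b => inner ℂ a b) 1 hv hw (hv.1.inner hw.1)
    (ae_of_all _ fun ω => by simpa using nnnorm_inner_le_nnnorm (𝕜 := ℂ) (v ω) (w ω))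

theorem integrable_top_mul {𝕜 : Type} [RCLike 𝕜] {f g : Freq → 𝕜} (hf : MemLp f ∞ freqMeasure)
    (hg : Integrable g freqMeasure) : Integrable (fun ω => f ω * g ω) freqMeasure :=
  memLp_one_iff_integrable.1 ((memLp_one_iff_integrable.2 hg).mul' hf)

theorem memLp_norm_sq {E : Type} [NormedAddCommGroup E] {v : Freq → E}
    (hv : MemLp v ∞ freqMeasure) : MemLp (fun ω => ‖v ω‖ ^ 2) ∞ freqMeasure := by
  simp only [sq]
  exact hv.norm.mul' hv.norm

theorem memLp_act {p : ℝ≥0∞} {M : Freq → Matrix ι κ ℂ} {v : Freq → CVec κ}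
    (hM : ∀ i j, MemLp (fun ω => M ω i j) ∞ freqMeasure) (hv : MemLp v p freqMeasure) :
    MemLp (fun ω => act (M ω) (v ω)) p freqMeasure := by
  refine MemLp.of_eval_piLp fun i => ?_
  simp only [act_apply]
  exact memLp_finsetSum _ fun j _ => (hv.eval_piLp j).mul' (hM i j)

theorem MemHardy.add {p : ℝ≥0∞} (hp : 1 ≤ p) {f g : Freq → ℂ} (hf : MemHardy p f)
    (hg : MemHardy p g) : MemHardy p fun ω => f ω + g ω :=
  ⟨hf.1.add hg.1, fun t ht => by
    rw [markov_add (hf.1.integrable hp) (hg.1.integrable hp), hf.2 t ht, hg.2 t ht, add_zero]⟩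

theorem MemHardy.const_mul {p : ℝ≥0∞} {f : Freq → ℂ} (hf : MemHardy p f) (c : ℂ) :
    MemHardy p fun ω => c * f ω :=
  ⟨hf.1.const_mul c, fun t ht => by rw [markov_const_mul, hf.2 t ht, mul_zero]⟩

theorem MemHardy.sum {p : ℝ≥0∞} (hp : 1 ≤ p) {α : Type} (s : Finset α) {f : α → Freq → ℂ}
    (hf : ∀ i, MemHardy p (f i)) : MemHardy p fun ω => ∑ i ∈ s, f i ω := by
  classical
  induction s using Finset.induction_on with
  | empty => exact ⟨by simp, fun t _ => by simp [markov_eq_integral]⟩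
  | insert i s hi ih =>
    simp only [Finset.sum_insert hi]
    exact (hf i).add hp ih

theorem MemHardy.mul {p : ℝ≥0∞} (hp : 2 ≤ p) {f g : Freq → ℂ} (hf : MemHardy ∞ f)
    (hg : MemHardy p g) : MemHardy p fun ω => f ω * g ω :=
  ⟨hg.1.mul' hf.1, isCausal_mul (hf.1.mono_exponent le_top) (hg.1.mono_exponent hp) hf.2 hg.2⟩

theorem markov_apply {v : Freq → CVec ι} (hv : Integrable v freqMeasure) (t : ℤ) (i : ι) :
    markov v t i = markov (fun ω => v ω i) t := by
  simp only [markov, fourierCoeff]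
  exact eval_integral_piLp (fun i => (hv.fourier_smul _).eval_piLp i) i

theorem memHardy_iff_apply {p : ℝ≥0∞} (hp : 1 ≤ p) {v : Freq → CVec ι} :
    MemHardy p v ↔ ∀ i, MemHardy p fun ω => v ω i := by
  constructor
  · exact fun h i => ⟨h.1.eval_piLp i, fun t ht => by
      rw [← markov_apply (h.1.integrable hp), h.2 t ht]; rfl⟩
  · intro h
    have h1 : MemLp v p freqMeasure := MemLp.of_eval_piLp fun i => (h i).1
    refine ⟨h1, fun t ht => ?_⟩
    ext i
    rw [markov_apply (h1.integrable hp), (h i).2 t ht]; rfl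

theorem memHardy_act {p : ℝ≥0∞} (hp : 2 ≤ p) {M : Freq → Matrix ι κ ℂ} {v : Freq → CVec κ}
    (hM : ∀ i j, MemHardy ∞ fun ω => M ω i j) (hv : MemHardy p v) :
    MemHardy p fun ω => act (M ω) (v ω) := by
  have hp1 : 1 ≤ p := le_trans (by norm_num) hp
  refine (memHardy_iff_apply hp1).2 fun i => ?_
  simp only [act_apply]
  exact MemHardy.sum hp1 _ fun j => (hM i j).mul hp ((memHardy_iff_apply hp1).1 hv j)

theorem MemHardy.vec_add_smul {v w : Freq → CVec ι} (hv : MemHardy ∞ v) (hw : MemHardy ∞ w)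
    (c : ℂ) : MemHardy ∞ fun ω => v ω + c • w ω :=
  (memHardy_iff_apply le_top).2 fun i =>
    ((memHardy_iff_apply le_top).1 hv i).add le_top
      (((memHardy_iff_apply le_top).1 hw i).const_mul c)

/-- The reflection `ω ↦ conj (v (-ω))` conjugates the Markov parameters. -/
theorem MemHardy.reflect {v : Freq → CVec ι} (hv : MemHardy ∞ v) :
    MemHardy ∞ fun ω => conjVec (v (-ω)) := by
  refine (memHardy_iff_apply le_top).2 fun i => ?_
  have hi := (memHardy_iff_apply le_top).1 hv i
  have h := (hi.1.comp_measurePreserving (Measure.measurePreserving_neg freqMeasure)).star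
  refine ⟨h, fun t ht => ?_⟩
  refine (markov_conj (fun ω => v (-ω) i) t).trans ?_
  rw [markov_comp_neg (fun ω => v ω i), neg_neg, hi.2 t ht, map_zero]

theorem isController_iff {du : ℕ} {K : Freq → CVec (Fin du)} :
    IsController K ↔ MemHardy ∞ K ∧ ∀ᵐ ω ∂freqMeasure, K (-ω) = conjVec (K ω) := by
  refine and_congr_right fun hK => ?_
  have hKi := hK.1.integrable le_top
  constructor
  · intro h
    have h1 : ∀ i, ∀ᵐ ω ∂freqMeasure, K (-ω) i = conj (K ω i) := fun i =>
      ae_comp_neg_eq_conj (f := fun ω => K ω i) (hKi.eval_piLp i) fun t => by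
        rw [← markov_apply hKi, h]
    filter_upwards [ae_all_iff.2 h1] with ω hω
    ext i
    exact hω i
  · intro h t i
    rw [markov_apply hKi]
    refine markov_im_eq_zero (f := fun ω => K ω i) ?_ t
    filter_upwards [h] with ω hω
    rw [hω, conjVec_apply]

theorem ae_comp_neg {p : Freq → Prop} (h : ∀ᵐ ω ∂freqMeasure, p ω) :
    ∀ᵐ ω ∂freqMeasure, p (-ω) :=
  (Measure.measurePreserving_neg freqMeasure).quasiMeasurePreserving.ae h

theorem IsDualVariable.ae_comp_neg {Λ : Freq → ℝ} (hΛ : IsDualVariable Λ) :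
    ∀ᵐ ω ∂freqMeasure, Λ (-ω) = Λ ω := by
  filter_upwards [ae_comp_neg_eq_conj hΛ.1.ofReal hΛ.2.2] with ω hω
  exact Complex.ofReal_injective (hω.trans (Complex.conj_ofReal _))

end Hardy

/-! ### Minimisation over the controllers -/

namespace LTISystem

variable {dx du ds : ℕ} {P : LTISystem dx du ds}

theorem memLp_controlOutput
    (hA : P.NoUnitEigenvalue) {p : ℝ≥0∞}
    {H : Freq → CVec (Fin du)} (hH : MemLp H p freqMeasure) :
    MemLp (fun ω => P.controlOutput (H ω) ω) p freqMeasure := by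
  refine MemLp.of_eval_piLp fun i => ?_
  rcases i with i | i
  · exact (memLp_act (fun i j => memLp_of_continuous
      ((P.continuous_F hA).matrix_elem i j) ∞) hH).eval_piLp i
  · exact hH.eval_piLp i

theorem memLp_closedLoop
    (hA : P.NoUnitEigenvalue) {p : ℝ≥0∞}
    {K : Freq → CVec (Fin du)} (hK : MemLp K p freqMeasure) :
    MemLp (P.closedLoop K) p freqMeasure := by
  refine MemLp.of_eval_piLp fun i => ?_
  rcases i with i | i
  · exact ((memLp_act (fun i j => memLp_of_continuous
      ((P.continuous_F hA).matrix_elem i j) ∞) hK).add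
        (memLp_of_continuous (P.continuous_G hA) p)).eval_piLp i
  · exact hK.eval_piLp i

theorem integrable_inner_controlOutput_closedLoop
    (hA : P.NoUnitEigenvalue)
    {K H : Freq → CVec (Fin du)} (hK : MemLp K ∞ freqMeasure) (hH : MemLp H ∞ freqMeasure)
    {Λ : Freq → ℝ} (hΛ : Integrable Λ freqMeasure) :
    Integrable (fun ω => inner ℂ (P.controlOutput (H ω) ω) (P.closedLoop K ω) *
      ((1 + Λ ω : ℝ) : ℂ)) freqMeasure :=
  integrable_top_mul (memLp_inner (memLp_controlOutput hA hH) (memLp_closedLoop hA hK))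
    ((integrable_const 1).add hΛ).ofReal

/-- The Lagrangian is quadratic in the controller. -/
theorem lagrangian_eq_add
    (hA : P.NoUnitEigenvalue) (γ : ℝ)
    {K K' H : Freq → CVec (Fin du)} (hK : MemLp K ∞ freqMeasure) (hH : MemLp H ∞ freqMeasure)
    {Λ : Freq → ℝ} (hΛ : Integrable Λ freqMeasure) (c : ℝ)
    (hK' : ∀ ω, K' ω = K ω + (c : ℂ) • H ω) :
    P.lagrangian γ K' Λ = P.lagrangian γ K Λ +
      2 * c * (∫ ω, inner ℂ (P.controlOutput (H ω) ω) (P.closedLoop K ω) *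
        ((1 + Λ ω : ℝ) : ℂ) ∂freqMeasure).re +
      c ^ 2 * ∫ ω, ‖P.controlOutput (H ω) ω‖ ^ 2 * (1 + Λ ω) ∂freqMeasure := by
  have hΛ1 : Integrable (fun ω => 1 + Λ ω) freqMeasure := (integrable_const 1).add hΛ
  have i1 := integrable_inner_controlOutput_closedLoop hA hK hH hΛ
  have i2 := integrable_top_mul (memLp_norm_sq (memLp_closedLoop hA hK)) hΛ1
  have i3 := integrable_top_mul (memLp_norm_sq (memLp_controlOutput hA hH)) hΛ1
  have hpt : ∀ ω, ‖P.closedLoop K' ω‖ ^ 2 * (1 + Λ ω) = ‖P.closedLoop K ω‖ ^ 2 * (1 + Λ ω) +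
      2 * c * RCLike.re (inner ℂ (P.controlOutput (H ω) ω) (P.closedLoop K ω) *
        ((1 + Λ ω : ℝ) : ℂ)) + c ^ 2 * (‖P.controlOutput (H ω) ω‖ ^ 2 * (1 + Λ ω)) := by
    intro ω
    have hc : ‖(c : ℂ)‖ ^ 2 = c ^ 2 := by simp
    rw [P.closedLoop_sub K K', hK', add_sub_cancel_left, controlOutput_smul, @norm_add_sq ℂ,
      inner_smul_right, norm_smul, mul_pow, hc, ← inner_conj_symm]
    simp only [RCLike.re_to_complex, Complex.re_ofReal_mul, Complex.re_mul_ofReal, Complex.conj_re]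
    ring
  have j1 : Integrable (fun ω => 2 * c * RCLike.re (inner ℂ (P.controlOutput (H ω) ω)
      (P.closedLoop K ω) * ((1 + Λ ω : ℝ) : ℂ))) freqMeasure := i1.re.const_mul _
  have i12 : Integrable (fun ω => ‖P.closedLoop K ω‖ ^ 2 * (1 + Λ ω) + 2 * c * RCLike.re
      (inner ℂ (P.controlOutput (H ω) ω) (P.closedLoop K ω) * ((1 + Λ ω : ℝ) : ℂ)))
      freqMeasure := i2.add j1
  simp only [lagrangian, hpt]
  rw [integral_add i12 (i3.const_mul _), integral_add i2 j1, integral_const_mul,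
    integral_const_mul, integral_re i1]
  simp only [RCLike.re_to_complex]
  ring

section Primal

variable {γ : ℝ}
  {Δ : Freq → Matrix (Fin du) (Fin du) ℂ} {K : Freq → CVec (Fin du)} {Λ : Freq → ℝ}
  {L : Freq → ℂ}

/-- The first variation vanishes at a minimiser. Controllers with real Markov parameters give real
directions; a direction `H` with complex Markov parameters is replaced by the sum of `H` and its
reflection `ω ↦ conj (H (-ω))`, whose first variation is the complex conjugate of that of `H`. -/
theorem integral_inner_eq_zero_of_minimal (hA : P.NoUnitEigenvalue)
    (hK : IsController K) (hΛ : IsDualVariable Λ)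
    (hmin : ∀ K', IsController K' → P.lagrangian γ K Λ ≤ P.lagrangian γ K' Λ)
    {H : Freq → CVec (Fin du)} (hH : MemHardy ∞ H) :
    ∫ ω, inner ℂ (P.controlOutput (H ω) ω) (P.closedLoop K ω) *
      ((1 + Λ ω : ℝ) : ℂ) ∂freqMeasure = 0 := by
  obtain ⟨hKH, hKs⟩ := isController_iff.1 hK
  have hreal : ∀ H : Freq → CVec (Fin du), IsController H →
      (∫ ω, inner ℂ (P.controlOutput (H ω) ω) (P.closedLoop K ω) *
        ((1 + Λ ω : ℝ) : ℂ) ∂freqMeasure).re = 0 := by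
    intro H hH
    obtain ⟨hHH, hHs⟩ := isController_iff.1 hH
    -- The Lagrangian along `K + c H` is quadratic in `c` and minimal at `c = 0`, so its linear
    -- coefficient vanishes.
    have hq : ∀ c : ℝ, 0 ≤ (∫ ω, ‖P.controlOutput (H ω) ω‖ ^ 2 * (1 + Λ ω) ∂freqMeasure) * (c * c) +
        (2 * (∫ ω, inner ℂ (P.controlOutput (H ω) ω) (P.closedLoop K ω) *
          ((1 + Λ ω : ℝ) : ℂ) ∂freqMeasure).re) * c + 0 := by
      intro c
      have hc : IsController fun ω => K ω + (c : ℂ) • H ω := by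
        refine isController_iff.2 ⟨hKH.vec_add_smul hHH c, ?_⟩
        filter_upwards [hKs, hHs] with ω h1 h2
        ext i
        simp [h1, h2]
      have h := hmin _ hc
      rw [lagrangian_eq_add hA γ hKH.1 hHH.1 hΛ.1 c fun ω => rfl] at h
      linarith
    have hd := discrim_le_zero hq
    rw [discrim] at hd
    nlinarith
  have hre : ∀ H : Freq → CVec (Fin du), MemHardy ∞ H →
      (∫ ω, inner ℂ (P.controlOutput (H ω) ω) (P.closedLoop K ω) *
        ((1 + Λ ω : ℝ) : ℂ) ∂freqMeasure).re = 0 := by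
    intro H hH
    have hc : IsController fun ω => H ω + (1 : ℂ) • conjVec (H (-ω)) := by
      refine isController_iff.2 ⟨hH.vec_add_smul hH.reflect 1, ae_of_all _ fun ω => ?_⟩
      ext i
      simp [add_comm]
    have h := hreal _ hc
    have hsum : ∀ ω, inner ℂ (P.controlOutput (H ω + (1 : ℂ) • conjVec (H (-ω))) ω)
        (P.closedLoop K ω) * ((1 + Λ ω : ℝ) : ℂ) =
        inner ℂ (P.controlOutput (H ω) ω) (P.closedLoop K ω) * ((1 + Λ ω : ℝ) : ℂ) +
        inner ℂ (P.controlOutput (conjVec (H (-ω))) ω) (P.closedLoop K ω) *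
          ((1 + Λ ω : ℝ) : ℂ) := by
      intro ω
      rw [one_smul, controlOutput_add, inner_add_left, add_mul]
    simp only [hsum] at h
    rw [integral_add (integrable_inner_controlOutput_closedLoop hA hKH.1 hH.1 hΛ.1)
      (integrable_inner_controlOutput_closedLoop hA hKH.1 hH.reflect.1 hΛ.1), Complex.add_re] at h
    have hrefl : ∫ ω, inner ℂ (P.controlOutput (conjVec (H (-ω))) ω) (P.closedLoop K ω) *
          ((1 + Λ ω : ℝ) : ℂ) ∂freqMeasure =
        conj (∫ ω, inner ℂ (P.controlOutput (H ω) ω) (P.closedLoop K ω) *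
          ((1 + Λ ω : ℝ) : ℂ) ∂freqMeasure) := by
      rw [← integral_neg_eq_self, ← integral_conj]
      refine integral_congr_ae ?_
      filter_upwards [hKs, hΛ.ae_comp_neg] with ω h1 h2
      rw [neg_neg, controlOutput_conjVec, P.closedLoop_neg h1, inner_conjVec, h2, map_mul,
        Complex.conj_ofReal]
    rw [hrefl, Complex.conj_re] at h
    linarith
  refine Complex.ext (hre H hH) ?_
  have hI : MemHardy ∞ fun ω => Complex.I • H ω :=
    (memHardy_iff_apply le_top).2 fun i => ((memHardy_iff_apply le_top).1 hH i).const_mul _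
  have h := hre _ hI
  simp only [controlOutput_smul, inner_smul_left, mul_assoc] at h
  rw [integral_const_mul] at h
  simpa using h

end Primal

end LTISystem

/-! ### Spectral factors of the multiplier -/

section SpectralFactor

variable {Λ : Freq → ℝ} {L : Freq → ℂ}

theorem IsSpectralFactor.norm_sq (hL : IsSpectralFactor Λ L) :
    ∀ᵐ ω ∂freqMeasure, ‖L ω‖ ^ 2 = 1 + Λ ω := by
  filter_upwards [hL.2.2] with ω hω
  rw [Complex.mul_conj, Complex.normSq_eq_norm_sq] at hω
  exact Complex.ofReal_injective hω

theorem IsSpectralFactor.one_le_norm (hL : IsSpectralFactor Λ L) (hΛ : IsDualVariable Λ) :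
    ∀ᵐ ω ∂freqMeasure, 1 ≤ ‖L ω‖ := by
  filter_upwards [hL.norm_sq, hΛ.2.1] with ω h1 h2
  nlinarith [norm_nonneg (L ω)]

theorem IsSpectralFactor.memHardy_inv (hL : IsSpectralFactor Λ L) (hΛ : IsDualVariable Λ) :
    MemHardy ∞ fun ω => (L ω)⁻¹ := by
  refine ⟨MemLp.of_bound hL.1.1.1.inv₀ 1 ?_, hL.2.1⟩
  filter_upwards [hL.one_le_norm hΛ] with ω hω
  rw [norm_inv]
  exact inv_le_one_of_one_le₀ hω

theorem memHardy_fourier_neg {t : ℤ} (ht : 0 ≤ t) :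
    MemHardy ∞ fun ω : Freq => (fourier (-t) ω : ℂ) :=
  ⟨memLp_fourier _ _, fun s hs => by rw [markov_fourier, if_neg (by omega)]⟩

theorem isDualVariable_of_even (hi : Integrable Λ freqMeasure)
    (h0 : ∀ᵐ ω ∂freqMeasure, 0 ≤ Λ ω) (he : ∀ᵐ ω ∂freqMeasure, Λ (-ω) = Λ ω) :
    IsDualVariable Λ := by
  refine ⟨hi, h0, fun t => markov_im_eq_zero (f := fun ω => (Λ ω : ℂ)) ?_ t⟩
  filter_upwards [he] with ω hω
  rw [hω, Complex.conj_ofReal]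

theorem isDualVariable_zero : IsDualVariable fun _ => 0 :=
  isDualVariable_of_even (integrable_zero _ _ _) (ae_of_all _ fun _ => le_rfl)
    (ae_of_all _ fun _ => rfl)

theorem isSpectralFactor_one : IsSpectralFactor (fun _ => 0) fun _ => 1 := by
  have h : IsCausal fun _ : Freq => (1 : ℂ) := by
    simpa using (memHardy_fourier_neg le_rfl).2
  exact ⟨⟨memLp_const 1, h⟩, by simpa using h, by simp⟩

end SpectralFactor

namespace LTISystem

variable {dx du ds : ℕ} {P : LTISystem dx du ds}

/-! ### The saddle point conditions -/

section Saddle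

variable {γ : ℝ} {Δ : Freq → Matrix (Fin du) (Fin du) ℂ} {K : Freq → CVec (Fin du)}
  {Λ : Freq → ℝ} {L : Freq → ℂ}

theorem memLp_smul_act (hΔ : P.IsPlantFactor Δ) (hL : MemLp L 2 freqMeasure)
    {v : Freq → CVec (Fin du)} (hv : MemLp v ∞ freqMeasure) :
    MemLp (fun ω => L ω • act (Δ ω) (v ω)) 2 freqMeasure := by
  have h := memLp_act (fun i j => (hΔ.1 i j).1) hv
  exact MemLp.of_eval_piLp fun i => (h.eval_piLp i).mul' hL

theorem memHardy_smul_act (hΔ : P.IsPlantFactor Δ) (hL : MemHardy 2 L)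
    {v : Freq → CVec (Fin du)} (hv : MemHardy ∞ v) :
    MemHardy 2 fun ω => L ω • act (Δ ω) (v ω) := by
  refine (memHardy_iff_apply (by norm_num)).2 fun i => ?_
  have h := ((memHardy_iff_apply le_top).1 (memHardy_act le_top hΔ.1 hv) i).mul le_rfl hL
  simpa only [PiLp.smul_apply, smul_eq_mul, mul_comm] using h

theorem ae_isUnit_det (hΔ : P.IsPlantFactor Δ) : ∀ᵐ ω ∂freqMeasure, IsUnit (Δ ω).det := by
  filter_upwards [hΔ.2.2] with ω hω
  exact isUnit_det_of_conjTranspose_mul_self hω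

theorem memLp_noncausal (hA : P.NoUnitEigenvalue) : MemLp P.noncausal ∞ freqMeasure :=
  memLp_of_continuous (P.continuous_noncausal hA) ∞

theorem memLp_smul_act_noncausal (hA : P.NoUnitEigenvalue) (hΔ : P.IsPlantFactor Δ)
    (hL : MemLp L 2 freqMeasure) (j : Fin du) :
    MemLp (fun ω => (L ω • act (Δ ω) (P.noncausal ω)) j) 2 freqMeasure :=
  (memLp_smul_act hΔ hL (memLp_noncausal hA)).eval_piLp j

/-- The splitting of `L Δ K_∘` into its causal and strictly anticausal parts, recognised from any
such splitting. -/
theorem ae_eq_S (hA : P.NoUnitEigenvalue) (hΔ : P.IsPlantFactor Δ) (hL : MemLp L 2 freqMeasure)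
    {p q : Freq → CVec (Fin du)} (hp : MemHardy 2 p) (hq : MemLp q 2 freqMeasure)
    (hqc : ∀ j t, 0 ≤ t → markov (fun ω => q ω j) t = 0)
    (h : ∀ᵐ ω ∂freqMeasure, L ω • act (Δ ω) (P.noncausal ω) = p ω + q ω) :
    q =ᵐ[freqMeasure] P.S Δ L := by
  have hj : ∀ j, ∀ᵐ ω ∂freqMeasure, q ω j = P.S Δ L ω j := fun j => by
    have hpj := (memHardy_iff_apply (by norm_num)).1 hp j
    refine ae_eq_anticausalPartScalar (memLp_smul_act_noncausal hA hΔ hL j) hpj.1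
      (hq.eval_piLp j) hpj.2 (hqc j) ?_
    filter_upwards [h] with ω hω
    rw [hω, PiLp.add_apply]
  filter_upwards [ae_all_iff.2 hj] with ω hω
  ext j
  exact hω j

theorem memLp_S (P : LTISystem dx du ds) (Δ : Freq → Matrix (Fin du) (Fin du) ℂ)
    (L : Freq → ℂ) : MemLp (P.S Δ L) 2 freqMeasure :=
  MemLp.of_eval_piLp fun _ => memLp_anticausalPartScalar

theorem markov_S (hA : P.NoUnitEigenvalue) (hΔ : P.IsPlantFactor Δ) (hL : MemLp L 2 freqMeasure)
    (j : Fin du) (t : ℤ) (ht : 0 ≤ t) : markov (fun ω => P.S Δ L ω j) t = 0 :=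
  markov_anticausalPartScalar (memLp_smul_act_noncausal hA hΔ hL j) ht

/-- Wiener-Hopf equation: `K` minimises the Lagrangian exactly when `Δ K L` is the causal part of
`Δ K_∘ L`. In one direction the first variation is tested on `Δ⁻¹ L⁻¹ z^{-t} e_j`, which is causal
and bounded because `Δ⁻¹` and `L⁻¹` are; in the other, `Δ (K' - K) L` is causal and hence orthogonal
to the strictly anticausal `S`. -/
theorem forall_lagrangian_le_iff (hA : P.NoUnitEigenvalue) (hΔ : P.IsPlantFactor Δ)
    (hK : IsController K) (hΛ : IsDualVariable Λ) (hL : IsSpectralFactor Λ L) :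
    (∀ K', IsController K' → P.lagrangian γ K Λ ≤ P.lagrangian γ K' Λ) ↔
      ∀ᵐ ω ∂freqMeasure, L ω • act (Δ ω) (P.noncausal ω - K ω) = P.S Δ L ω := by
  constructor
  · intro hmin
    refine ae_eq_S hA hΔ hL.1.1 (memHardy_smul_act hΔ hL.1 hK.1)
      (memLp_smul_act hΔ hL.1.1 ((memLp_noncausal hA).sub hK.1.1)) (fun j t ht => ?_)
      (ae_of_all _ fun ω => ?_)
    · let H : Freq → CVec (Fin du) := fun ω =>
        WithLp.toLp 2 fun i => (fourier (-t) ω * (L ω)⁻¹) * (Δ ω)⁻¹ i j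
      have hH : MemHardy ∞ H := (memHardy_iff_apply le_top).2 fun i =>
        ((memHardy_fourier_neg ht).mul le_top (hL.memHardy_inv hΛ)).mul le_top (hΔ.2.1 i j)
      have h := integral_inner_eq_zero_of_minimal hA hK hΛ hmin hH
      rw [markov_eq_integral, ← neg_eq_zero, ← integral_neg, ← h]
      refine integral_congr_ae ?_
      filter_upwards [hΔ.2.2, ae_isUnit_det hΔ, hL.2.2, hL.one_le_norm hΛ] with ω h1 h2 h3 h4
      have hL0 : L ω ≠ 0 := norm_pos_iff.1 (zero_lt_one.trans_le h4)
      have hHω : act (Δ ω) (H ω) =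
          (fourier (-t) ω * (L ω)⁻¹ : ℂ) • EuclideanSpace.single j (1 : ℂ) := by
        have : H ω = (fourier (-t) ω * (L ω)⁻¹ : ℂ) •
            act (Δ ω)⁻¹ (EuclideanSpace.single j (1 : ℂ)) := by
          ext i
          simp [H, act_apply]
        rw [this, act_smul, ← act_mul, Matrix.mul_nonsing_inv _ h2, act_one]
      rw [inner_controlOutput_closedLoop h1, hHω, inner_smul_left, EuclideanSpace.inner_single_left,
        ← h3, map_mul, fourier_neg, Complex.conj_conj, map_inv₀,
        ← neg_sub (K ω) (P.noncausal ω), act_neg]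
      have hc0 : conj (L ω) ≠ 0 := (map_ne_zero _).2 hL0
      simp only [PiLp.smul_apply, PiLp.neg_apply, smul_eq_mul, map_one]
      field_simp
    · rw [← smul_add, ← act_add, add_sub_cancel]
  · intro hS K' hK'
    have hH : MemHardy ∞ fun ω => K' ω - K ω := by
      simpa [sub_eq_add_neg] using hK'.1.vec_add_smul hK.1 (-1)
    have hP := (memHardy_iff_apply (by norm_num)).1 (memHardy_smul_act hΔ hL.1 hH)
    have hzero : ∫ ω, inner ℂ (P.controlOutput (K' ω - K ω) ω) (P.closedLoop K ω) *
        ((1 + Λ ω : ℝ) : ℂ) ∂freqMeasure = 0 := by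
      have hpt : ∀ᵐ ω ∂freqMeasure,
          inner ℂ (P.controlOutput (K' ω - K ω) ω) (P.closedLoop K ω) * ((1 + Λ ω : ℝ) : ℂ) =
          -∑ j, conj ((L ω • act (Δ ω) (K' ω - K ω)) j) * P.S Δ L ω j := by
        filter_upwards [hS, hΔ.2.2, hL.2.2] with ω h1 h2 h3
        have h4 : ∑ j, conj ((L ω • act (Δ ω) (K' ω - K ω)) j) * P.S Δ L ω j =
            inner ℂ (L ω • act (Δ ω) (K' ω - K ω)) (P.S Δ L ω) := by
          simp only [PiLp.inner_apply, RCLike.inner_apply, mul_comm]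
        rw [inner_controlOutput_closedLoop h2, h4, ← h1, ← h3, ← neg_sub (K ω) (P.noncausal ω),
          act_neg, smul_neg, inner_neg_right, inner_smul_left, inner_smul_right]
        ring
      rw [integral_congr_ae hpt, integral_neg, integral_finsetSum, Finset.sum_eq_zero, neg_zero]
      · exact fun j _ => integral_conj_mul_eq_zero (hP j).1 ((memLp_S P Δ L).eval_piLp j) (hP j).2
          fun t ht => markov_S hA hΔ hL.1.1 j t ht
      · exact fun j _ => memLp_one_iff_integrable.1
          (((memLp_S P Δ L).eval_piLp j).mul' (hP j).1.star)
    rw [lagrangian_eq_add hA γ (K' := K') hK.1.1 hH.1 hΛ.1 1 fun ω => by simp, hzero]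
    have h0 : 0 ≤ ∫ ω, ‖P.controlOutput (K' ω - K ω) ω‖ ^ 2 * (1 + Λ ω) ∂freqMeasure := by
      refine integral_nonneg_of_ae ?_
      filter_upwards [hΛ.2.1] with ω hω
      exact mul_nonneg (sq_nonneg _) (by linarith)
    simpa using h0

/-- Complementary slackness: `Λ` maximises the Lagrangian exactly when `‖T_K‖ ≤ γ` and `Λ` vanishes
where the inequality is strict. The test multipliers are `0`, `2 Λ` and
`max (‖T_K‖² - γ²) 0`. -/
theorem forall_le_lagrangian_iff (hA : P.NoUnitEigenvalue) (hK : IsController K)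
    (hΛ : IsDualVariable Λ) :
    (∀ Λ', IsDualVariable Λ' → P.lagrangian γ K Λ' ≤ P.lagrangian γ K Λ) ↔
      ∀ᵐ ω ∂freqMeasure, ‖P.closedLoop K ω‖ ^ 2 ≤ γ ^ 2 ∧
        Λ ω * (γ ^ 2 - ‖P.closedLoop K ω‖ ^ 2) = 0 := by
  have hT := memLp_norm_sq (memLp_closedLoop hA hK.1.1)
  set g : Freq → ℝ := fun ω => γ ^ 2 - ‖P.closedLoop K ω‖ ^ 2 with hg_def
  have hg : MemLp g ∞ freqMeasure := (memLp_const (γ ^ 2)).sub hT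
  have hlag : ∀ Λ', IsDualVariable Λ' → P.lagrangian γ K Λ' =
      (∫ ω, ‖P.closedLoop K ω‖ ^ 2 ∂freqMeasure) - ∫ ω, g ω * Λ' ω ∂freqMeasure := by
    intro Λ' hΛ'
    have i1 := integrable_top_mul hT hΛ'.1
    have i2 : Integrable (fun ω => ‖P.closedLoop K ω‖ ^ 2) freqMeasure := hT.integrable le_top
    have i3 : Integrable (fun ω => γ ^ 2 * Λ' ω) freqMeasure := hΛ'.1.const_mul _
    simp only [lagrangian, hg_def, mul_add, mul_one, sub_mul]
    rw [integral_add i2 i1, integral_sub i3 i1, integral_const_mul]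
    ring
  have hiff : (∀ Λ', IsDualVariable Λ' → P.lagrangian γ K Λ' ≤ P.lagrangian γ K Λ) ↔
      ∀ Λ', IsDualVariable Λ' →
        ∫ ω, g ω * Λ ω ∂freqMeasure ≤ ∫ ω, g ω * Λ' ω ∂freqMeasure := by
    refine forall₂_congr fun Λ' hΛ' => ?_
    rw [hlag Λ' hΛ', hlag Λ hΛ]
    constructor <;> intro h <;> linarith
  rw [hiff]
  constructor
  · intro h
    have h1 := h _ isDualVariable_zero
    simp only [mul_zero, integral_zero] at h1
    have h2 := h (fun ω => 2 * Λ ω) <| isDualVariable_of_even (hΛ.1.const_mul 2)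
      (by filter_upwards [hΛ.2.1] with ω hω; positivity)
      (by filter_upwards [hΛ.ae_comp_neg] with ω hω; rw [hω])
    simp only [mul_left_comm _ (2 : ℝ)] at h2
    rw [integral_const_mul] at h2
    have hm : MemLp (fun ω => max (-g ω) 0) ∞ freqMeasure :=
      hg.of_le (hg.1.neg.sup aestronglyMeasurable_const) (ae_of_all _ fun ω => by
        rw [Real.norm_eq_abs, Real.norm_eq_abs, abs_of_nonneg (le_max_right _ _)]
        exact max_le (neg_le_abs _) (abs_nonneg _))
    have hm_even : ∀ᵐ ω ∂freqMeasure, max (-g (-ω)) 0 = max (-g ω) 0 := by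
      filter_upwards [(isController_iff.1 hK).2] with ω hω
      simp only [hg_def, P.closedLoop_neg hω, norm_conjVec]
    have h3 := h _ <| isDualVariable_of_even (hm.integrable le_top)
      (ae_of_all _ fun ω => le_max_right _ _) hm_even
    have hpt : ∀ ω, g ω * max (-g ω) 0 = -(max (-g ω) 0) ^ 2 := fun ω => by
      rcases le_total (-g ω) 0 with h | h
      · simp [max_eq_right h]
      · rw [max_eq_left h]; ring
    simp only [hpt, integral_neg] at h3
    have h4 : (fun ω => (max (-g ω) 0) ^ 2) =ᵐ[freqMeasure] 0 := by
      have hi : Integrable (fun ω => (max (-g ω) 0) ^ 2) freqMeasure := by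
        simpa only [sq] using (hm.mul' hm (r := ∞)).integrable le_top
      refine (integral_eq_zero_iff_of_nonneg (fun ω => sq_nonneg _) hi).1
        (le_antisymm (by linarith) (integral_nonneg fun ω => sq_nonneg _))
    have h5 : ∀ᵐ ω ∂freqMeasure, 0 ≤ g ω := by
      filter_upwards [h4] with ω hω
      have h6 : max (-g ω) 0 = 0 := pow_eq_zero_iff two_ne_zero |>.1 hω
      linarith [le_max_left (-g ω) 0]
    have h6 : (fun ω => g ω * Λ ω) =ᵐ[freqMeasure] 0 := by
      refine (integral_eq_zero_iff_of_nonneg_ae ?_ (integrable_top_mul hg hΛ.1)).1 (by linarith)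
      filter_upwards [h5, hΛ.2.1] with ω h7 h8
      exact mul_nonneg h7 h8
    filter_upwards [h5, h6] with ω h7 h8
    exact ⟨sub_nonneg.1 h7, (mul_comm _ _).trans h8⟩
  · intro h Λ' hΛ'
    refine integral_mono_ae (integrable_top_mul hg hΛ.1) (integrable_top_mul hg hΛ'.1) ?_
    filter_upwards [h, hΛ'.2.1] with ω h1 h2
    have h3 : g ω * Λ ω = 0 := (mul_comm _ _).trans h1.2
    simp only [h3]
    exact mul_nonneg (sub_nonneg.2 h1.1) h2

/-- An optimal `H_2` controller minimises the Lagrangian with multiplier `0`, so `Δ K₂` is the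
causal part of `Δ K_∘`. -/
theorem IsH2Optimal.ae_eq_anticausalPart (hA : P.NoUnitEigenvalue) (hΔ : P.IsPlantFactor Δ)
    {K₂ : Freq → CVec (Fin du)} (hK₂ : P.IsH2Optimal K₂) :
    ∀ᵐ ω ∂freqMeasure, anticausalPart (fun η => act (Δ η) (P.noncausal η)) ω =
      act (Δ ω) (P.noncausal ω - K₂ ω) := by
  have hmin : ∀ K', IsController K' →
      P.lagrangian 0 K₂ (fun _ => 0) ≤ P.lagrangian 0 K' fun _ => 0 := by
    intro K' hK'
    have h := hK₂.2 K' hK'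
    have hm : ∀ K, IsController K → MemLp (P.closedLoop K) 2 freqMeasure := fun K hK =>
      (memLp_closedLoop hA hK.1.1).mono_exponent le_top
    rw [hsNorm, hsNorm, (hm _ hK₂.1).eLpNorm_eq_integral_rpow_norm (by norm_num) (by norm_num),
      (hm _ hK').eLpNorm_eq_integral_rpow_norm (by norm_num) (by norm_num),
      ENNReal.ofReal_le_ofReal_iff (by positivity),
      Real.rpow_le_rpow_iff (by positivity) (by positivity) (by norm_num)] at h
    simpa [lagrangian] using h
  have h := (forall_lagrangian_le_iff hA hΔ hK₂.1 isDualVariable_zero isSpectralFactor_one).1 hmin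
  filter_upwards [h] with ω hω
  simpa [S] using hω.symm

theorem ae_eq_wienerHopf_iff (hA : P.NoUnitEigenvalue) (hΔ : P.IsPlantFactor Δ)
    (hΛ : IsDualVariable Λ) (hL : IsSpectralFactor Λ L)
    {K₂ : Freq → CVec (Fin du)} (hK₂ : P.IsH2Optimal K₂) :
    K =ᵐ[freqMeasure] P.wienerHopf K₂ Δ L ↔
      ∀ᵐ ω ∂freqMeasure, L ω • act (Δ ω) (P.noncausal ω - K ω) = P.S Δ L ω := by
  have hN := hK₂.ae_eq_anticausalPart hA hΔ
  set N := anticausalPart fun η => act (Δ η) (P.noncausal η)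
  -- `{Δ K_∘}₋ = Δ (K_∘ - K₂)` is bounded, so `{Δ K_∘}₋ L` is square integrable.
  have hLN : MemLp (fun ω => L ω • N ω) 2 freqMeasure := by
    refine (memLp_congr_ae ?_).1
      (memLp_smul_act hΔ hL.1.1 ((memLp_noncausal hA).sub hK₂.1.1.1))
    filter_upwards [hN] with ω hω
    rw [hω]; rfl
  have hcausal : MemHardy 2 (causalPart fun ω => L ω • N ω) :=
    (memHardy_iff_apply (by norm_num)).2 fun j =>
      ⟨memLp_causalPartScalar, causalPartScalar_isCausal (hLN.eval_piLp j)⟩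
  have hsplit : ∀ᵐ ω ∂freqMeasure, causalPart (fun θ => L θ • N θ) ω +
      anticausalPart (fun θ => L θ • N θ) ω = L ω • N ω := by
    filter_upwards [ae_all_iff.2 fun j =>
      causalPartScalar_add_anticausalPartScalar (hLN.eval_piLp j)] with ω hω
    ext j
    exact hω j
  have hLK₂ := memHardy_smul_act hΔ hL.1 hK₂.1.1
  have hsum : MemHardy 2 fun ω =>
      causalPart (fun θ => L θ • N θ) ω + L ω • act (Δ ω) (K₂ ω) :=
    (memHardy_iff_apply (by norm_num)).2 fun j =>
      ((memHardy_iff_apply (by norm_num)).1 hcausal j).add (by norm_num)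
        ((memHardy_iff_apply (by norm_num)).1 hLK₂ j)
  have hS : anticausalPart (fun θ => L θ • N θ) =ᵐ[freqMeasure] P.S Δ L := by
    refine ae_eq_S hA hΔ hL.1.1 hsum (MemLp.of_eval_piLp fun _ => memLp_anticausalPartScalar)
      (fun j t ht => markov_anticausalPartScalar (hLN.eval_piLp j) ht) ?_
    filter_upwards [hsplit, hN] with ω h1 h2
    rw [add_right_comm, h1, h2, ← smul_add, ← act_add, sub_add_cancel]
  have hpt : ∀ᵐ ω ∂freqMeasure, K ω = P.wienerHopf K₂ Δ L ω ↔
      L ω • act (Δ ω) (P.noncausal ω - K ω) = P.S Δ L ω := by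
    filter_upwards [hsplit, hN, hS, ae_isUnit_det hΔ, hL.one_le_norm hΛ] with ω h1 h2 h3 h4 h5
    have hL0 : L ω ≠ 0 := norm_pos_iff.1 (zero_lt_one.trans_le h5)
    have hinv : ∀ v, act (Δ ω)⁻¹ (act (Δ ω) v) = v := fun v => by
      rw [← act_mul, Matrix.nonsing_inv_mul _ h4, act_one]
    have hinv' : ∀ v, act (Δ ω) (act (Δ ω)⁻¹ v) = v := fun v => by
      rw [← act_mul, Matrix.mul_nonsing_inv _ h4, act_one]
    have hW : P.wienerHopf K₂ Δ L ω = P.noncausal ω - (L ω)⁻¹ • act (Δ ω)⁻¹ (P.S Δ L ω) := by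
      rw [wienerHopf, eq_sub_of_add_eq h1, h3, h2, act_sub, act_smul, hinv, smul_sub,
        inv_smul_smul₀ hL0]
      abel
    rw [hW]
    constructor
    · intro h
      rw [h, sub_sub_cancel, act_smul, hinv', smul_inv_smul₀ hL0]
    · intro h
      rw [← h, act_smul, hinv, inv_smul_smul₀ hL0, sub_sub_cancel]
  exact ⟨fun h => by filter_upwards [h, hpt] with ω h1 h2 using h2.1 h1,
    fun h => by filter_upwards [h, hpt] with ω h1 h2 using h2.2 h1⟩

theorem exists_gap (hγ : P.gammaInf < ENNReal.ofReal γ) :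
    ∃ ε : ℝ, 0 < ε ∧ ∀ᵐ ω ∂freqMeasure, ε ≤ γ ^ 2 - ‖P.closedLoop P.noncausal ω‖ ^ 2 := by
  simp only [gammaInf, iInf_lt_iff] at hγ
  obtain ⟨K, -, hKγ⟩ := hγ
  have hne : P.opNorm K ≠ ∞ := hKγ.ne_top
  have hlt : (P.opNorm K).toReal < γ := (ENNReal.lt_ofReal_iff_toReal_lt hne).1 hKγ
  have h0 : 0 ≤ (P.opNorm K).toReal := ENNReal.toReal_nonneg
  refine ⟨γ ^ 2 - (P.opNorm K).toReal ^ 2, by nlinarith, ?_⟩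
  filter_upwards [ae_le_eLpNormEssSup (f := P.closedLoop K) (μ := freqMeasure)] with ω hω
  rw [← eLpNorm_exponent_top, ← opNorm, ← ENNReal.ofReal_toReal hne, ← ofReal_norm,
    ENNReal.ofReal_le_ofReal_iff h0] at hω
  have h1 := P.norm_sq_closedLoop_noncausal_le K ω
  nlinarith [norm_nonneg (P.closedLoop K ω)]

/-- Once the Wiener-Hopf equation holds, `‖T_K‖² = ‖T_{K_∘}‖² + ‖S‖² / ‖L‖²`, and complementary
slackness becomes the scalar optimality condition. -/
theorem scalarCondition_iff (hγ : P.gammaInf < ENNReal.ofReal γ) (hΔ : P.IsPlantFactor Δ)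
    (hΛ : IsDualVariable Λ) (hL : IsSpectralFactor Λ L)
    (hS : ∀ᵐ ω ∂freqMeasure, L ω • act (Δ ω) (P.noncausal ω - K ω) = P.S Δ L ω) :
    (∀ᵐ ω ∂freqMeasure, ‖P.closedLoop K ω‖ ^ 2 ≤ γ ^ 2 ∧
      Λ ω * (γ ^ 2 - ‖P.closedLoop K ω‖ ^ 2) = 0) ↔ P.ScalarCondition γ Δ L := by
  obtain ⟨ε, hε, hgap⟩ := exists_gap hγ
  refine eventually_congr ?_
  filter_upwards [hgap, hS, hΔ.2.2, hL.norm_sq, hΛ.2.1] with ω h1 h2 h3 h4 h5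
  have hs : ‖P.S Δ L ω‖ ^ 2 = (1 + Λ ω) * ‖act (Δ ω) (K ω - P.noncausal ω)‖ ^ 2 := by
    rw [← h2, norm_smul, mul_pow, h4, ← neg_sub (K ω), act_neg, norm_neg]
  rw [h4, hs, norm_sq_closedLoop h3]
  set n := ‖P.closedLoop P.noncausal ω‖ ^ 2
  set a := ‖act (Δ ω) (K ω - P.noncausal ω)‖ ^ 2
  have hY : 0 < γ ^ 2 - n := hε.trans_le h1
  have ha : 0 ≤ a := sq_nonneg _
  constructor
  · rintro ⟨h6, h7⟩
    rcases mul_eq_zero.1 h7 with h8 | h8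
    · rw [h8, add_zero, one_mul, max_eq_right ((div_le_one hY).2 (by linarith))]
    · have h9 : a = γ ^ 2 - n := by linarith
      rw [h9, mul_div_assoc, div_self hY.ne', mul_one, max_eq_left (by linarith)]
  · intro h
    have h6 : (1 + Λ ω) * a / (γ ^ 2 - n) ≤ 1 + Λ ω := (le_max_left _ _).trans_eq h.symm
    rw [div_le_iff₀ hY] at h6
    have h7 : a ≤ γ ^ 2 - n := le_of_mul_le_mul_left h6 (by linarith)
    refine ⟨by linarith, ?_⟩
    rcases max_choice ((1 + Λ ω) * a / (γ ^ 2 - n)) 1 with h8 | h8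
    · rw [h8, eq_div_iff hY.ne'] at h
      have h9 := mul_left_cancel₀ (by linarith : (1 + Λ ω) ≠ 0) h
      rw [← sub_sub, h9, sub_self, mul_zero]
    · rw [h8] at h
      rw [show Λ ω = 0 by linarith, zero_mul]

end Saddle

end LTISystem

end MixedControl

end

theorem mainTheorem3 {dx du ds : ℕ} (P : MixedControl.LTISystem dx du ds)
    (hA : ∀ z : ℂ, ‖z‖ = 1 → z ∉ spectrum ℂ (P.A.map Complex.ofReal))
    (γ : ℝ) (hγ : P.gammaInf < ENNReal.ofReal γ)
    (Δ : MixedControl.Freq → Matrix (Fin du) (Fin du) ℂ) (hΔ : P.IsPlantFactor Δ)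
    (K : MixedControl.Freq → MixedControl.CVec (Fin du)) (hK : MixedControl.IsController K)
    (Λ : MixedControl.Freq → ℝ) (hΛ : MixedControl.IsDualVariable Λ)
    (L : MixedControl.Freq → ℂ) (hL : MixedControl.IsSpectralFactor Λ L) :
    (∃ ε : ℝ, 0 < ε ∧ ∀ᵐ ω ∂MixedControl.freqMeasure,
      ε ≤ γ ^ 2 - ‖P.closedLoop P.noncausal ω‖ ^ 2) ∧
    (P.IsSaddlePoint γ K Λ → P.ScalarCondition γ Δ L) ∧
    (∀ K₂ : MixedControl.Freq → MixedControl.CVec (Fin du), P.IsH2Optimal K₂ →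
      (P.IsSaddlePoint γ K Λ ↔
        (K =ᵐ[MixedControl.freqMeasure] P.wienerHopf K₂ Δ L) ∧ P.ScalarCondition γ Δ L)) := by
  have hprimal := MixedControl.LTISystem.forall_lagrangian_le_iff (γ := γ) hA hΔ hK hΛ hL
  have hdual := MixedControl.LTISystem.forall_le_lagrangian_iff (γ := γ) hA hK hΛ
  have hsaddle : P.IsSaddlePoint γ K Λ ↔
      (∀ᵐ ω ∂MixedControl.freqMeasure,
        L ω • MixedControl.act (Δ ω) (P.noncausal ω - K ω) = P.S Δ L ω) ∧
      P.ScalarCondition γ Δ L := by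
    constructor
    · rintro ⟨-, -, h1, h2⟩
      have hS := hprimal.1 h1
      exact ⟨hS, (MixedControl.LTISystem.scalarCondition_iff hγ hΔ hΛ hL hS).1 (hdual.1 h2)⟩
    · rintro ⟨hS, h⟩
      exact ⟨hK, hΛ, hprimal.2 hS,
        hdual.2 ((MixedControl.LTISystem.scalarCondition_iff hγ hΔ hΛ hL hS).2 h)⟩
  refine ⟨MixedControl.LTISystem.exists_gap hγ, fun h => (hsaddle.1 h).2, fun K₂ hK₂ => ?_⟩
  rw [hsaddle, MixedControl.LTISystem.ae_eq_wienerHopf_iff hA hΔ hΛ hL hK₂]
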